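/- Let $(M,\omega=d\lambda)$ be an exact symplectic manifold (smooth, finite-dimensional, without boundary) and let $H\in C^\infty(M\times[0,1],\mathbb R)$; write $H_r=H(\cdot,r)$ for $r\in[0,1]$. Assume that for every $r\in[0,1]$ the number $0$ is a regular value of $H_r$ and the level set $H_r^{-1}(0)$ is connected, and that $H^{-1}(0)\subset M\times[0,1]$ is compact. Assume moreover that for every $r\in[0,1]$ the restriction $\lambda|_{H_r^{-1}(0)}$ is a contact form, and let $R_r$ be its Reeb vector field, i.e. the vector field on $H_r^{-1}(0)$ determined by $\lambda(R_r)=1$ and $d\lambda(R_r,v)=0$ for all $v$ tangent to $H_r^{-1}(0)$. Let $(\gamma_r,\tau_r)$, $r\in[0,1)$, be a smooth family of periodic Reeb orbits $\gamma_r$ with period $\tau_r$; that is, $\tau_r\in(0,\infty)$ depends smoothly on $r\in[0,1)$, the map $(r,t)\mapsto\gamma_r(t)\in M$ is smooth on $[0,1)\times\mathbb R/\mathbb Z$, and for all $r\in[0,1)$ the curve $\gamma_r$ lies in $H_r^{-1}(0)$ and satisfies $\partial_t\gamma_r=\tau_r R_r(\gamma_r)$. Then there exists $\tau_1\in(0,\infty)$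 such that $\tau_r\to\tau_1$ as $r\to1$, $r<1$. -/

import Mathlib

open Set Filter Topology
open scoped Manifold ContDiff Bundle

/-- The pointwise type of (not necessarily smooth) real-valued 1-forms on a manifold `M` without
boundary modelled on `E`. -/
abbrev OneForm (E : Type*) [NormedAddCommGroup E] [NormedSpace ℝ E] (M : Type*)
    [TopologicalSpace M] [ChartedSpace E M] : Type _ :=
  (x : M) → TangentSpace 𝓘(ℝ, E) x →L[ℝ] ℝ

section

variable {E : Type*} [NormedAddCommGroup E] [NormedSpace ℝ E]
variable {M : Type*} [TopologicalSpace M] [ChartedSpace E M]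

/-- A 1-form is smooth if it is a smooth section of the cotangent bundle. -/
def OneForm.IsSmooth [IsManifold 𝓘(ℝ, E) ∞ M] (lam : OneForm E M) : Prop :=
  ContMDiff 𝓘(ℝ, E) (𝓘(ℝ, E).prod 𝓘(ℝ, E →L[ℝ] ℝ)) ∞
    (fun x ↦ Bundle.TotalSpace.mk' (E →L[ℝ] ℝ)
      (E := fun x : M ↦ TangentSpace 𝓘(ℝ, E) x →L[ℝ] Bundle.Trivial M ℝ x) x (lam x))

/-- The 1-form `lam` in the preferred chart `φ` around `x₀`, i.e. the pullback
`(φ⁻¹)^* lam` as a 1-form on (the target of the chart in) `E`. -/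
noncomputable def OneForm.inChart (lam : OneForm E M) (x₀ : M) (y : E) : E →L[ℝ] ℝ :=
  (lam ((extChartAt 𝓘(ℝ, E) x₀).symm y)).comp
    (mfderiv 𝓘(ℝ, E) 𝓘(ℝ, E) (extChartAt 𝓘(ℝ, E) x₀).symm y)

/-- The exterior derivative `(d lam)_x (u, v)`, computed in the preferred chart `φ` around `x`:
it is `φ^* d ((φ⁻¹)^* lam)`. -/
noncomputable def OneForm.extD (lam : OneForm E M) (x : M) (u v : TangentSpace 𝓘(ℝ, E) x) : ℝ :=
  extDeriv
    (fun y : E ↦ ContinuousAlternatingMap.ofSubsingleton ℝ E ℝ (0 : Fin 1) (lam.inChart x y))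
    (extChartAt 𝓘(ℝ, E) x x)
    ![mfderiv 𝓘(ℝ, E) 𝓘(ℝ, E) (extChartAt 𝓘(ℝ, E) x) x u,
      mfderiv 𝓘(ℝ, E) 𝓘(ℝ, E) (extChartAt 𝓘(ℝ, E) x) x v]

/-- `(M, d lam)` is an exact symplectic manifold: `lam` is a smooth 1-form and the (automatically
closed) 2-form `d lam` is nondegenerate at every point. -/
structure IsExactSymplectic [IsManifold 𝓘(ℝ, E) ∞ M] (lam : OneForm E M) : Prop where
  smooth : lam.IsSmooth
  nondegenerate : ∀ (x : M) (u : TangentSpace 𝓘(ℝ, E) x), (∀ v, lam.extD x u v = 0) → u = 0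

/-- `0` is a regular value of `h`. -/
def ZeroIsRegularValue (h : M → ℝ) : Prop :=
  ∀ x : M, h x = 0 → Function.Surjective (mvfderiv 𝓘(ℝ, E) h x)

/-- The tangent space at `x` of the level set of `h` through the regular point `x`, that is
`ker (dh)_x`. -/
noncomputable def levelTangent (h : M → ℝ) (x : M) : Submodule ℝ (TangentSpace 𝓘(ℝ, E) x) :=
  LinearMap.ker (mvfderiv 𝓘(ℝ, E) h x : TangentSpace 𝓘(ℝ, E) x →ₗ[ℝ] ℝ)

/-- The restriction `α` of `lam` to the regular level set `Σ = h⁻¹(0)` is a contact form: at each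
point, `α` is nonzero on `TΣ`, and `dα = (d lam)|_{TΣ}` is nondegenerate on `ker α ⊆ TΣ`. -/
def IsContactOnZeroSet (lam : OneForm E M) (h : M → ℝ) : Prop :=
  ∀ x : M, h x = 0 →
    (∃ v ∈ levelTangent h x, lam x v ≠ 0) ∧
    ∀ u ∈ levelTangent h x, lam x u = 0 →
      (∀ v ∈ levelTangent h x, lam x v = 0 → lam.extD x u v = 0) → u = 0

/-- `R` is the value at `x ∈ Σ = h⁻¹(0)` of the Reeb vector field of the contact form
`α = lam|_Σ`: it is tangent to `Σ`, `α(R) = 1`, and `dα(R, ·) = 0` on `TΣ`. -/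
structure IsReebVector (lam : OneForm E M) (h : M → ℝ) (x : M)
    (R : TangentSpace 𝓘(ℝ, E) x) : Prop where
  mem_zeroSet : h x = 0
  tangent : R ∈ levelTangent h x
  normalized : lam x R = 1
  kernel : ∀ v ∈ levelTangent h x, lam.extD x R v = 0

/-- A smooth family `(γ_r, τ_r)`, `r ∈ [0,1)`, of periodic Reeb orbits on the level sets
`H_r⁻¹(0)`. The orbit `γ_r` of period `τ_r > 0` is parametrized over `S¹ = ℝ/ℤ`, that is as a
`1`-periodic curve with `∂_t γ_r = τ_r R_r(γ_r)`, where `R_r` is the Reeb vector field. -/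
structure IsPeriodicReebFamily (lam : OneForm E M) (H : ℝ → M → ℝ)
    (γ : ℝ → ℝ → M) (τ : ℝ → ℝ) : Prop where
  smooth_orbit : ContMDiffOn 𝓘(ℝ, ℝ × ℝ) 𝓘(ℝ, E) ∞ (fun p : ℝ × ℝ ↦ γ p.1 p.2)
    (Ico (0 : ℝ) 1 ×ˢ univ)
  smooth_period : ContDiffOn ℝ ∞ τ (Ico 0 1)
  period_pos : ∀ r ∈ Ico (0 : ℝ) 1, 0 < τ r
  periodic : ∀ r ∈ Ico (0 : ℝ) 1, Function.Periodic (γ r) 1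
  velocity : ∀ r ∈ Ico (0 : ℝ) 1, ∀ t : ℝ,
    ∃ R : TangentSpace 𝓘(ℝ, E) (γ r t), IsReebVector lam (H r) (γ r t) R ∧
      HasMFDerivAt 𝓘(ℝ, ℝ) 𝓘(ℝ, E) (γ r) t
        ((1 : ℝ →L[ℝ] ℝ).smulRight (τ r • R))

end

/-! Because λ(∂_t γ_r) = τ_r, the period is the action of the orbit, and its growth is controlled by
a first variation formula. With u = ∂_r γ it reads ∂_t(λ(u)) = τ_r' - τ_r dλ(u, R_r)
(`IsPeriodicReebFamily.hasDerivAt_variation`). As λ(u) takes equal values at t = 0 and t = 1,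
Rolle's theorem gives a t with τ_r' = τ_r dλ(u, R_r).

The pairing dλ(u, R_r) is bounded although u itself need not be. Differentiating H_r(γ_r(t)) = 0 in
r gives dH_r(u) = -∂_r H, and dλ(R_r, ·) vanishes on ker dH_r, so it is a multiple of dH_r. Hence
the pairing depends only on R_r and ∂_r H, which are bounded on the compact set H⁻¹(0), up to and
including r = 1 (`exists_abs_extD_reeb_le`).

So |τ'| ≤ C τ, and log τ is Lipschitz on (0,1). It has a finite limit at 1, and τ has a positive one
(`exists_tendsto_of_abs_deriv_le_mul`). -/

lemma two_le_infty : (2 : ℕ∞ω) ≤ ∞ := WithTop.coe_le_coe.2 (le_top : (2 : ℕ∞) ≤ ⊤)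

/-! ### One-forms, exterior derivatives and differentials in charts -/

section ChartExpressions

variable {E : Type*} [NormedAddCommGroup E] [NormedSpace ℝ E]
variable {M : Type*} [TopologicalSpace M] [ChartedSpace E M]

/-- The derivative at `x` of the preferred chart around `x₀`, as an endomorphism of the model
space. -/
noncomputable def chartDeriv (x₀ x : M) : E →L[ℝ] E :=
  mfderiv 𝓘(ℝ, E) 𝓘(ℝ, E) (extChartAt 𝓘(ℝ, E) x₀) x

/-- The derivative at `y` of the inverse of the preferred chart around `x₀`, as an endomorphism of
the model space. -/
noncomputable def chartSymmDeriv (x₀ : M) (y : E) : E →L[ℝ] E :=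
  mfderiv 𝓘(ℝ, E) 𝓘(ℝ, E) (extChartAt 𝓘(ℝ, E) x₀).symm y

/-- The exterior derivative of `lam` in the preferred chart around `x₀`, as a bilinear map. -/
noncomputable def OneForm.dInChart (lam : OneForm E M) (x₀ : M) (y : E) : E →L[ℝ] E →L[ℝ] ℝ :=
  fderiv ℝ (lam.inChart x₀) y - (fderiv ℝ (lam.inChart x₀) y).flip

lemma OneForm.dInChart_apply (lam : OneForm E M) (x₀ : M) (y u v : E) :
    lam.dInChart x₀ y u v =
      fderiv ℝ (lam.inChart x₀) y u v - fderiv ℝ (lam.inChart x₀) y v u := rfl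

lemma OneForm.dInChart_swap (lam : OneForm E M) (x₀ : M) (y u v : E) :
    lam.dInChart x₀ y u v = -lam.dInChart x₀ y v u := by
  simp [OneForm.dInChart_apply]

lemma extDeriv_ofSubsingleton_apply {A : E → E →L[ℝ] ℝ} {y : E} (hA : DifferentiableAt ℝ A y)
    (u v : E) :
    extDeriv (fun y ↦ ContinuousAlternatingMap.ofSubsingleton ℝ E ℝ (0 : Fin 1) (A y)) y ![u, v] =
      fderiv ℝ A y u v - fderiv ℝ A y v u := by
  have h : DifferentiableAt ℝ
      (fun y ↦ ContinuousAlternatingMap.ofSubsingleton ℝ E ℝ (0 : Fin 1) (A y)) y :=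
    (ContinuousAlternatingMap.ofSubsingletonLIE (𝕜 := ℝ) (E := E) (F := ℝ)
      (0 : Fin 1)).differentiable.differentiableAt.comp y hA
  rw [extDeriv_apply h]
  have key : ∀ w : E, fderiv ℝ (fun y ↦ A y w) y = (fderiv ℝ A y).flip w := by
    intro w
    ext z
    rw [fderiv_clm_apply hA (differentiableAt_const w)]
    simp
  simp [Fin.sum_univ_two, Fin.removeNth, key, sub_eq_add_neg]

lemma mem_chart_source_of_mem_extChartAt {x₀ x : M}
    (hx : x ∈ (extChartAt 𝓘(ℝ, E) x₀).source) : x ∈ (chartAt E x₀).source := by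
  simpa using hx

/-- The value of a 1-form at a point, as a linear form on the model space. -/
def OneForm.toModel (lam : OneForm E M) (x : M) : E →L[ℝ] ℝ := lam x

/-- The cotangent space depends on the base point, so `φ⁻¹(φ x) = x` cannot be rewritten freely.
`toModel` places the forms in one fixed space, where the equality can be transported. -/
lemma OneForm.inChart_extChartAt (lam : OneForm E M) {x₀ x : M}
    (hx : x ∈ (extChartAt 𝓘(ℝ, E) x₀).source) :
    lam.inChart x₀ (extChartAt 𝓘(ℝ, E) x₀ x) =
      (lam.toModel x).comp (chartSymmDeriv x₀ (extChartAt 𝓘(ℝ, E) x₀ x)) := by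
  have h : lam.toModel
      ((extChartAt 𝓘(ℝ, E) x₀).symm (extChartAt 𝓘(ℝ, E) x₀ x)) = (lam.toModel x) := by
    rw [(extChartAt 𝓘(ℝ, E) x₀).left_inv hx]
  exact congrArg (fun L : E →L[ℝ] ℝ ↦
    L.comp (chartSymmDeriv x₀ (extChartAt 𝓘(ℝ, E) x₀ x))) h

variable [IsManifold 𝓘(ℝ, E) ∞ M]

lemma chartSymmDeriv_chartDeriv {x₀ x : M} (hx : x ∈ (extChartAt 𝓘(ℝ, E) x₀).source) (v : E) :
    chartSymmDeriv x₀ (extChartAt 𝓘(ℝ, E) x₀ x) (chartDeriv x₀ x v) = v := by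
  have h := mfderivWithin_extChartAt_symm_comp_mfderiv_extChartAt' (I := 𝓘(ℝ, E)) hx
  rw [modelWithCornersSelf_coe, range_id, mfderivWithin_univ] at h
  exact DFunLike.congr_fun h v

lemma chartDeriv_chartSymmDeriv {x₀ x : M} (hx : x ∈ (extChartAt 𝓘(ℝ, E) x₀).source) (v : E) :
    chartDeriv x₀ x (chartSymmDeriv x₀ (extChartAt 𝓘(ℝ, E) x₀ x) v) = v := by
  have h := mfderiv_extChartAt_comp_mfderivWithin_extChartAt_symm' (I := 𝓘(ℝ, E)) hx
  rw [modelWithCornersSelf_coe, range_id, mfderivWithin_univ] at h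
  exact DFunLike.congr_fun h v

lemma OneForm.apply_eq_inChart (lam : OneForm E M) {x₀ x : M}
    (hx : x ∈ (extChartAt 𝓘(ℝ, E) x₀).source) (v : E) :
    (lam.toModel x) v =
      lam.inChart x₀ (extChartAt 𝓘(ℝ, E) x₀ x) (chartDeriv x₀ x v) := by
  rw [lam.inChart_extChartAt hx, ContinuousLinearMap.comp_apply, chartSymmDeriv_chartDeriv hx]

/-- Smoothness of a section means smoothness of its expression in the bundle trivialization at `x₀`.
The inverse of that trivialization is the derivative of the inverse chart, so the expression is
`inChart` composed with the chart; the chart is then undone. -/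
lemma OneForm.IsSmooth.contDiffAt_inChart {lam : OneForm E M} (hlam : lam.IsSmooth) (x₀ : M) :
    ContDiffAt ℝ ∞ (lam.inChart x₀) (extChartAt 𝓘(ℝ, E) x₀ x₀) := by
  have h := ((contMDiffAt_hom_bundle _).1 (hlam x₀)).2
  have h2 : ContMDiffAt 𝓘(ℝ, E) 𝓘(ℝ, E →L[ℝ] ℝ) ∞
      (fun x ↦ lam.inChart x₀ (extChartAt 𝓘(ℝ, E) x₀ x)) x₀ := by
    refine h.congr_of_eventuallyEq ?_
    filter_upwards [extChartAt_source_mem_nhds (I := 𝓘(ℝ, E)) x₀] with x hx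
    rw [lam.inChart_extChartAt hx, ContinuousLinearMap.inCoordinates]
    have h3 := TangentBundle.symmL_trivializationAt (I := 𝓘(ℝ, E)) (𝕜 := ℝ)
      (mem_chart_source_of_mem_extChartAt hx)
    rw [modelWithCornersSelf_coe, range_id, mfderivWithin_univ] at h3
    ext v
    have h4 := DFunLike.congr_fun h3 v
    have h6 : ∀ z : ℝ, (trivializationAt ℝ (Bundle.Trivial M ℝ) x₀).continuousLinearMapAt ℝ x z =
        z := fun z ↦
      DFunLike.congr_fun (Bundle.Trivial.continuousLinearMapAt_trivialization ℝ M ℝ x) z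
    simp only [ContinuousLinearMap.comp_apply]
    exact (congrArg (lam.toModel x) h4.symm).trans (h6 _).symm
  have h5 : ContMDiffAt 𝓘(ℝ, E) 𝓘(ℝ, E →L[ℝ] ℝ) ∞ (fun y ↦ lam.inChart x₀
      (extChartAt 𝓘(ℝ, E) x₀ ((extChartAt 𝓘(ℝ, E) x₀).symm y))) (extChartAt 𝓘(ℝ, E) x₀ x₀) := by
    refine ContMDiffAt.comp (I' := 𝓘(ℝ, E)) (extChartAt 𝓘(ℝ, E) x₀ x₀)
      (g := fun x ↦ lam.inChart x₀ (extChartAt 𝓘(ℝ, E) x₀ x))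
      (f := (extChartAt 𝓘(ℝ, E) x₀).symm) ?_ ?_
    · rwa [extChartAt_to_inv]
    · exact (contMDiffOn_extChartAt_symm x₀).contMDiffAt (extChartAt_target_mem_nhds x₀)
  refine (contMDiffAt_iff_contDiffAt.1 h5).congr_of_eventuallyEq ?_
  filter_upwards [extChartAt_target_mem_nhds (I := 𝓘(ℝ, E)) x₀] with y hy
  rw [(extChartAt 𝓘(ℝ, E) x₀).right_inv hy]

/-- The order is lowered to 2 because smoothness of infinite order at a point gives neighbourhoods
that may shrink with the order; a finite order spreads to one neighbourhood. -/
lemma OneForm.IsSmooth.eventually_contDiffAt_inChart {lam : OneForm E M} (hlam : lam.IsSmooth)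
    (x₀ : M) : ∀ᶠ y in 𝓝 (extChartAt 𝓘(ℝ, E) x₀ x₀), ContDiffAt ℝ 2 (lam.inChart x₀) y :=
  ((hlam.contDiffAt_inChart x₀).of_le two_le_infty).eventually (by simp)

lemma hasMFDerivAt_extChartAt_chartDeriv {x₀ x : M}
    (hx : x ∈ (extChartAt 𝓘(ℝ, E) x₀).source) :
    HasMFDerivAt 𝓘(ℝ, E) 𝓘(ℝ, E) (extChartAt 𝓘(ℝ, E) x₀) x (chartDeriv (E := E) x₀ x) := by
  exact (mdifferentiableAt_extChartAt (mem_chart_source_of_mem_extChartAt hx)).hasMFDerivAt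

lemma hasMFDerivAt_extChartAt_symm {x₀ : M} {y : E}
    (hy : y ∈ (extChartAt 𝓘(ℝ, E) x₀).target) :
    HasMFDerivAt 𝓘(ℝ, E) 𝓘(ℝ, E) (extChartAt 𝓘(ℝ, E) x₀).symm y (chartSymmDeriv (E := E) x₀ y) := by
  have h := mdifferentiableWithinAt_extChartAt_symm (I := 𝓘(ℝ, E)) hy
  rw [modelWithCornersSelf_coe, range_id, mdifferentiableWithinAt_univ] at h
  exact h.hasMFDerivAt

lemma hasFDerivAt_chart_transition {x₀ x : M} {y : E}
    (hy : y ∈ (extChartAt 𝓘(ℝ, E) x).target)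
    (hyx : (extChartAt 𝓘(ℝ, E) x).symm y ∈ (extChartAt 𝓘(ℝ, E) x₀).source) :
    HasFDerivAt (fun z ↦ extChartAt 𝓘(ℝ, E) x₀ ((extChartAt 𝓘(ℝ, E) x).symm z))
      ((chartDeriv x₀ ((extChartAt 𝓘(ℝ, E) x).symm y)).comp (chartSymmDeriv x y)) y :=
  hasMFDerivAt_iff_hasFDerivAt.1
    ((hasMFDerivAt_extChartAt_chartDeriv hyx).comp y (hasMFDerivAt_extChartAt_symm hy))

/-- The exterior derivative can be computed in any preferred chart. -/
lemma OneForm.extD_eq_dInChart (lam : OneForm E M) {x₀ x : M}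
    (hx : x ∈ (extChartAt 𝓘(ℝ, E) x₀).source)
    (hA : DifferentiableAt ℝ (lam.inChart x₀) (extChartAt 𝓘(ℝ, E) x₀ x)) (u v : E) :
    lam.extD x u v =
      lam.dInChart x₀ (extChartAt 𝓘(ℝ, E) x₀ x) (chartDeriv x₀ x u) (chartDeriv x₀ x v) := by
  set ψ : E → E := fun z ↦ extChartAt 𝓘(ℝ, E) x₀ ((extChartAt 𝓘(ℝ, E) x).symm z) with hψ
  set η : E → E [⋀^Fin 1]→L[ℝ] ℝ := fun y ↦
    ContinuousAlternatingMap.ofSubsingleton ℝ E ℝ (0 : Fin 1) (lam.inChart x₀ y) with hη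
  have hψx : ψ (extChartAt 𝓘(ℝ, E) x x) = extChartAt 𝓘(ℝ, E) x₀ x := by
    rw [hψ]; simp only [extChartAt_to_inv]
  have hnear : ∀ᶠ y in 𝓝 (extChartAt 𝓘(ℝ, E) x x), y ∈ (extChartAt 𝓘(ℝ, E) x).target ∧
      (extChartAt 𝓘(ℝ, E) x).symm y ∈ (extChartAt 𝓘(ℝ, E) x₀).source := by
    refine Eventually.and (extChartAt_target_mem_nhds (I := 𝓘(ℝ, E)) x) ?_
    refine (continuousAt_extChartAt_symm (I := 𝓘(ℝ, E)) x).eventually ?_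
    rw [extChartAt_to_inv]
    exact extChartAt_source_mem_nhds' hx
  -- On a whole neighbourhood, the form in the chart at `x` is the pullback by the transition map
  -- `ψ` of the form in the chart at `x₀`. The claim is then naturality of d under pullback.
  have hform : (fun y ↦ ContinuousAlternatingMap.ofSubsingleton ℝ E ℝ (0 : Fin 1)
      (lam.inChart x y)) =ᶠ[𝓝 (extChartAt 𝓘(ℝ, E) x x)]
      fun y ↦ (η (ψ y)).compContinuousLinearMap (fderiv ℝ ψ y) := by
    filter_upwards [hnear] with y hy
    rw [(hasFDerivAt_chart_transition hy.1 hy.2).fderiv, hη, hψ]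
    ext w
    simp only [ContinuousAlternatingMap.compContinuousLinearMap_apply,
      ContinuousAlternatingMap.ofSubsingleton_apply_apply, Function.comp_apply,
      ContinuousLinearMap.comp_apply]
    exact lam.apply_eq_inChart hy.2 (chartSymmDeriv x y (w 0))
  have hψs : ContDiffAt ℝ ∞ ψ (extChartAt 𝓘(ℝ, E) x x) := by
    refine contMDiffAt_iff_contDiffAt.1 ?_
    refine ContMDiffAt.comp (I' := 𝓘(ℝ, E)) (extChartAt 𝓘(ℝ, E) x x)
      (g := extChartAt 𝓘(ℝ, E) x₀) (f := (extChartAt 𝓘(ℝ, E) x).symm) ?_ ?_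
    · rw [extChartAt_to_inv]
      exact contMDiffAt_extChartAt' (mem_chart_source_of_mem_extChartAt hx)
    · exact (contMDiffOn_extChartAt_symm x).contMDiffAt (extChartAt_target_mem_nhds x)
  have hηd : DifferentiableAt ℝ η (ψ (extChartAt 𝓘(ℝ, E) x x)) := by
    rw [hψx]
    exact (ContinuousAlternatingMap.ofSubsingletonLIE (𝕜 := ℝ) (E := E) (F := ℝ)
      (0 : Fin 1)).differentiable.differentiableAt.comp _ hA
  have hx' := mem_extChartAt_source (I := 𝓘(ℝ, E)) x
  have hfd : ∀ w : E, fderiv ℝ ψ (extChartAt 𝓘(ℝ, E) x x) (chartDeriv x x w) =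
      chartDeriv x₀ x w := by
    intro w
    rw [(hasFDerivAt_chart_transition hnear.self_of_nhds.1 hnear.self_of_nhds.2).fderiv,
      ContinuousLinearMap.comp_apply, chartSymmDeriv_chartDeriv hx', extChartAt_to_inv]
  have hmain : lam.extD x u v = extDeriv (fun y ↦ ContinuousAlternatingMap.ofSubsingleton ℝ E ℝ
      (0 : Fin 1) (lam.inChart x y)) (extChartAt 𝓘(ℝ, E) x x)
      ![chartDeriv x x u, chartDeriv x x v] := rfl
  rw [hmain, hform.extDeriv_eq, extDeriv_pullback hηd hψs (by simpa using two_le_infty), hψx,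
    ContinuousAlternatingMap.compContinuousLinearMap_apply, lam.dInChart_apply,
    ← extDeriv_ofSubsingleton_apply hA]
  congr 1
  ext i
  fin_cases i
  · exact hfd u
  · exact hfd v

lemma mvfderiv_eq_of_hasFDerivAt_inChart {h : M → ℝ} {x₀ x : M}
    (hx : x ∈ (extChartAt 𝓘(ℝ, E) x₀).source) {L : E →L[ℝ] ℝ}
    (hL : HasFDerivAt (fun y ↦ h ((extChartAt 𝓘(ℝ, E) x₀).symm y)) L
      (extChartAt 𝓘(ℝ, E) x₀ x)) (v : E) :
    mvfderiv 𝓘(ℝ, E) h x v = L (chartDeriv x₀ x v) := by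
  have h1 : HasMFDerivAt 𝓘(ℝ, E) 𝓘(ℝ, ℝ) h x (L.comp (chartDeriv (E := E) x₀ x)) := by
    refine HasMFDerivAt.congr_of_eventuallyEq
      (hL.hasMFDerivAt.comp x (hasMFDerivAt_extChartAt_chartDeriv hx)) ?_
    filter_upwards [extChartAt_source_mem_nhds' (I := 𝓘(ℝ, E)) hx] with z hz
    simp only [Function.comp_apply, (extChartAt 𝓘(ℝ, E) x₀).left_inv hz]
  rw [mvfderiv, h1.mfderiv]
  rfl

lemma HasMFDerivAt.hasDerivAt_extChartAt {c : ℝ → M} {t : ℝ} {L : ℝ →L[ℝ] E} {x₀ : M}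
    (hc : HasMFDerivAt 𝓘(ℝ, ℝ) 𝓘(ℝ, E) c t L) (hx : c t ∈ (extChartAt 𝓘(ℝ, E) x₀).source) :
    HasDerivAt (fun s ↦ extChartAt 𝓘(ℝ, E) x₀ (c s)) (chartDeriv x₀ (c t) (L 1)) t := by
  have h := hasMFDerivAt_iff_hasFDerivAt.1 ((hasMFDerivAt_extChartAt_chartDeriv hx).comp t hc)
  exact (show HasFDerivAt (fun s ↦ extChartAt 𝓘(ℝ, E) x₀ (c s)) ((chartDeriv x₀ (c t)).comp L) t
    from h).hasDerivAt

end ChartExpressions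

/-! ### Linear algebra: bounds that persist near a limit -/

section BilinearNorm

variable {E : Type*} [NormedAddCommGroup E] [NormedSpace ℝ E]

/-- Shortcut for instance search. -/
noncomputable instance bilinearSeminormedAddCommGroup :
    SeminormedAddCommGroup (E →L[ℝ] E →L[ℝ] ℝ) :=
  ContinuousLinearMap.toSeminormedAddCommGroup

/-- Shortcut for instance search. -/
noncomputable instance bilinearNormedAddCommGroup : NormedAddCommGroup (E →L[ℝ] E →L[ℝ] ℝ) :=
  ContinuousLinearMap.toNormedAddCommGroup

end BilinearNorm

section LinearBounds

variable {E F X : Type*} [NormedAddCommGroup E] [NormedSpace ℝ E]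
  [NormedAddCommGroup F] [NormedSpace ℝ F] {l : Filter X}

lemma tendsto_clm_prod {G : Type*} [NormedAddCommGroup G] [NormedSpace ℝ G]
    {f : X → E →L[ℝ] F} {g : X → E →L[ℝ] G} {f₀ : E →L[ℝ] F} {g₀ : E →L[ℝ] G}
    (hf : Tendsto f l (𝓝 f₀)) (hg : Tendsto g l (𝓝 g₀)) :
    Tendsto (fun p ↦ (f p).prod (g p)) l (𝓝 (f₀.prod g₀)) :=
  ((ContinuousLinearMap.prodₗᵢ (𝕜 := ℝ) (E := E) (F := F) (G := G) ℝ).continuous.tendsto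
    (f₀, g₀)).comp (hf.prodMk_nhds hg)

lemma tendsto_clm_smulRight {f : X → E →L[ℝ] ℝ} {g : X → F} {f₀ : E →L[ℝ] ℝ} {g₀ : F}
    (hf : Tendsto f l (𝓝 f₀)) (hg : Tendsto g l (𝓝 g₀)) :
    Tendsto (fun p ↦ (f p).smulRight (g p)) l (𝓝 (f₀.smulRight g₀)) :=
  ((isBoundedBilinearMap_smulRight (𝕜 := ℝ) (E := E) (F := F)).continuous.tendsto
    (f₀, g₀)).comp (hf.prodMk_nhds hg)

variable [FiniteDimensional ℝ E]

/-- In finite dimension an injective map is bounded below, ‖u‖ ≤ K ‖L₀ u‖. A perturbation of norm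
less than 1/(2K) costs at most half of ‖u‖, whence the constant 2K. -/
lemma exists_eventually_norm_le_of_injective {L : X → E →L[ℝ] F} {L₀ : E →L[ℝ] F}
    (hL : Tendsto L l (𝓝 L₀)) (hinj : Function.Injective L₀) :
    ∃ K : ℝ, 0 < K ∧ ∀ᶠ p in l, ∀ u, ‖u‖ ≤ K * ‖L p u‖ := by
  obtain ⟨K, hK, hKL⟩ := LinearMap.exists_antilipschitzWith (L₀ : E →ₗ[ℝ] F)
    (LinearMap.ker_eq_bot.2 hinj)
  have hK' : (0 : ℝ) < K := hK
  refine ⟨2 * K, by positivity, ?_⟩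
  have hev : ∀ᶠ p in l, ‖L p - L₀‖ < 1 / (2 * K) :=
    (tendsto_iff_norm_sub_tendsto_zero.1 hL).eventually (gt_mem_nhds (by positivity))
  filter_upwards [hev] with p hp u
  have h1 : ‖u‖ ≤ K * ‖L₀ u‖ := ZeroHomClass.bound_of_antilipschitz L₀ hKL u
  have h2 : ‖(L p - L₀) u‖ ≤ 1 / (2 * K) * ‖u‖ :=
    ((L p - L₀).le_opNorm u).trans (by gcongr)
  have h3 : ‖L₀ u‖ ≤ ‖L p u‖ + ‖(L p - L₀) u‖ := by
    have : L₀ u = L p u - (L p - L₀) u := by simp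
    rw [this]
    exact norm_sub_le _ _
  have h4 : K * (1 / (2 * K) * ‖u‖) = ‖u‖ / 2 := by field_simp
  nlinarith

/-- Uniform bound for the pairing of Reeb vectors with vectors of prescribed transversal part, for
linear data converging to a contact limit. -/
lemma exists_eventually_abs_apply_reeb_le {α β : X → E →L[ℝ] ℝ} {B : X → E →L[ℝ] E →L[ℝ] ℝ}
    {δ : X → ℝ} {α₀ β₀ : E →L[ℝ] ℝ} {B₀ : E →L[ℝ] E →L[ℝ] ℝ} {δ₀ : ℝ}
    (hα : Tendsto α l (𝓝 α₀)) (hβ : Tendsto β l (𝓝 β₀)) (hB : Tendsto B l (𝓝 B₀))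
    (hδ : Tendsto δ l (𝓝 δ₀)) (hsurj : Function.Surjective β₀)
    (hcontact : ∀ u, β₀ u = 0 → α₀ u = 0 → (∀ v, β₀ v = 0 → B₀ u v = 0) → u = 0) :
    ∃ C : ℝ, ∀ᶠ p in l, ∀ R u, β p R = 0 → α p R = 1 → (∀ v, β p v = 0 → B p R v = 0) →
      β p u = -δ p → |B p R u| ≤ C := by
  -- A vector transversal to ker β₀; it stays transversal to the nearby kernels.
  obtain ⟨e, he⟩ := hsurj 1
  -- The condition "b(u, ·) vanishes on ker f" involves a moving subspace. Testing on f(e)v - f(v)e,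
  -- which lies in ker f for every v, turns it into T b f u = 0, an equation on the fixed space that
  -- is continuous in b and f.
  let T : (E →L[ℝ] E →L[ℝ] ℝ) → (E →L[ℝ] ℝ) → (E →L[ℝ] E →L[ℝ] ℝ) := fun b f ↦
    f e • b - (b.flip e).smulRight f
  have hT : ∀ b f u v, T b f u v = f e * b u v - b u e * f v := by
    intro b f u v
    simp [T]
  have hβe : Tendsto (fun p ↦ β p e) l (𝓝 (β₀ e)) :=
    ((ContinuousLinearMap.apply ℝ ℝ e).continuous.tendsto β₀).comp hβ
  have hBe : Tendsto (fun p ↦ (B p).flip e) l (𝓝 (B₀.flip e)) := by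
    have h1 := ((ContinuousLinearMap.flipₗᵢ ℝ E E ℝ).continuous.tendsto B₀).comp hB
    exact ((ContinuousLinearMap.apply ℝ (E →L[ℝ] ℝ) e).continuous.tendsto _).comp h1
  have hTt : Tendsto (fun p ↦ T (B p) (β p)) l (𝓝 (T B₀ β₀)) := by
    refine (hβe.smul hB).sub ?_
    exact tendsto_clm_smulRight hBe hβ
  have hL : Tendsto (fun p ↦ (T (B p) (β p)).prod ((β p).prod (α p))) l
      (𝓝 ((T B₀ β₀).prod (β₀.prod α₀))) :=
    tendsto_clm_prod hTt (tendsto_clm_prod hβ hα)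
  -- The contact condition says that (T, β, α) is injective at the limit. Reeb vectors are sent to
  -- (0, 0, 1), of norm 1, so they are bounded by K nearby.
  obtain ⟨K, hK, hKL⟩ := exists_eventually_norm_le_of_injective hL (by
    refine (injective_iff_map_eq_zero _).2 fun u hu ↦ ?_
    simp only [ContinuousLinearMap.prod_apply, Prod.mk_eq_zero] at hu
    refine hcontact u hu.2.1 hu.2.2 fun v hv ↦ ?_
    have h4 := hT B₀ β₀ u v
    rw [hu.1, hv, he] at h4
    simpa using h4.symm)
  -- The factor 2 comes from dividing by β(e) > 1/2 in β(e) B(R, u) = -B(R, e) δ.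
  refine ⟨2 * ((‖B₀‖ + 1) * K * ‖e‖ * (|δ₀| + 1)), ?_⟩
  have e1 : ∀ᶠ p in l, 1 / 2 < β p e :=
    hβe.eventually (lt_mem_nhds (by rw [he]; norm_num))
  have e2 : ∀ᶠ p in l, ‖B p‖ < ‖B₀‖ + 1 := hB.norm.eventually (gt_mem_nhds (by simp))
  have e3 : ∀ᶠ p in l, |δ p| < |δ₀| + 1 := hδ.abs.eventually (gt_mem_nhds (by simp))
  filter_upwards [hKL, e1, e2, e3] with p hp h1 h2 h3 R u hR1 hR2 hR3 hu
  have key : ∀ v, β p e * B p R v - B p R e * β p v = 0 := by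
    intro v
    have h := hR3 (β p e • v - β p v • e) (by simp [mul_comm])
    simp only [map_sub, map_smul, smul_eq_mul] at h
    linarith
  have hRK : ‖R‖ ≤ K := by
    have h := hp R
    have h0 : T (B p) (β p) R = 0 := by
      ext v
      rw [hT, key v]
      rfl
    simp only [ContinuousLinearMap.prod_apply, h0, hR1, hR2] at h
    simpa using h
  have hBRe : |B p R e| ≤ (‖B₀‖ + 1) * K * ‖e‖ :=
    ((B p).le_opNorm₂ R e).trans (by gcongr)
  have h5 : β p e * |B p R u| = |B p R e| * |δ p| := by
    have h6 : β p e * B p R u = -(B p R e * δ p) := by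
      have := key u
      rw [hu] at this
      linarith
    rw [← abs_mul, ← abs_neg (B p R e * δ p), ← h6, abs_mul,
      abs_of_pos (show 0 < β p e by linarith)]
  have h7 : |B p R e| * |δ p| ≤ (‖B₀‖ + 1) * K * ‖e‖ * (|δ₀| + 1) := by gcongr
  nlinarith [abs_nonneg (B p R u)]

end LinearBounds

/-! ### Uniform bounds along the family of level sets -/

section LevelSets

variable {E : Type*} [NormedAddCommGroup E] [NormedSpace ℝ E]
variable {M : Type*} [TopologicalSpace M] [ChartedSpace E M]

lemma uniqueDiffOn_target_prod_Icc (x₀ : M) :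
    UniqueDiffOn ℝ ((extChartAt 𝓘(ℝ, E) x₀).target ×ˢ Icc (0 : ℝ) 1) :=
  (isOpen_extChartAt_target x₀).uniqueDiffOn.prod (uniqueDiffOn_Icc zero_lt_one)

variable [IsManifold 𝓘(ℝ, E) ∞ M] {lam : OneForm E M} {H : ℝ → M → ℝ}

/-- A family of functions read in the preferred chart around `x₀`. -/
noncomputable def familyInChart (H : ℝ → M → ℝ) (x₀ : M) (q : E × ℝ) : ℝ :=
  H q.2 ((extChartAt 𝓘(ℝ, E) x₀).symm q.1)

lemma contDiffOn_familyInChart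
    (hH : ContMDiffOn (𝓘(ℝ, E).prod 𝓘(ℝ, ℝ)) 𝓘(ℝ, ℝ) ∞ (fun p : M × ℝ ↦ H p.2 p.1)
      (univ ×ˢ Icc (0 : ℝ) 1)) (x₀ : M) :
    ContDiffOn ℝ ∞ (familyInChart (E := E) H x₀)
      ((extChartAt 𝓘(ℝ, E) x₀).target ×ˢ Icc (0 : ℝ) 1) := by
  rw [← contMDiffOn_iff_contDiffOn]
  refine hH.comp (f := fun q : E × ℝ ↦ ((extChartAt 𝓘(ℝ, E) x₀).symm q.1, q.2)) ?_ ?_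
  · refine ContMDiffOn.prodMk ?_ contDiff_snd.contMDiff.contMDiffOn
    exact (contMDiffOn_extChartAt_symm x₀).comp contDiff_fst.contMDiff.contMDiffOn
      fun q hq ↦ hq.1
  · exact fun q hq ↦ ⟨mem_univ _, hq.2⟩

/-- The derivative of a family of functions in the preferred chart around `x₀`, one-sided at the
ends of the parameter interval. -/
noncomputable def familyFDeriv (H : ℝ → M → ℝ) (x₀ : M) (q : E × ℝ) : E × ℝ →L[ℝ] ℝ :=
  fderivWithin ℝ (familyInChart (E := E) H x₀)
    ((extChartAt 𝓘(ℝ, E) x₀).target ×ˢ Icc (0 : ℝ) 1) q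

lemma hasFDerivWithinAt_familyInChart
    (hH : ContMDiffOn (𝓘(ℝ, E).prod 𝓘(ℝ, ℝ)) 𝓘(ℝ, ℝ) ∞ (fun p : M × ℝ ↦ H p.2 p.1)
      (univ ×ˢ Icc (0 : ℝ) 1)) {x₀ x : M} (hx : x ∈ (extChartAt 𝓘(ℝ, E) x₀).source) {r : ℝ}
    (hr : r ∈ Icc (0 : ℝ) 1) :
    HasFDerivWithinAt (familyInChart (E := E) H x₀)
      (familyFDeriv H x₀ (extChartAt 𝓘(ℝ, E) x₀ x, r))
      ((extChartAt 𝓘(ℝ, E) x₀).target ×ˢ Icc (0 : ℝ) 1) (extChartAt 𝓘(ℝ, E) x₀ x, r) :=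
  (((contDiffOn_familyInChart hH x₀).differentiableOn (by simp)) _
    ⟨(extChartAt 𝓘(ℝ, E) x₀).map_source hx, hr⟩).hasFDerivWithinAt

lemma hasFDerivAt_familyInChart
    (hH : ContMDiffOn (𝓘(ℝ, E).prod 𝓘(ℝ, ℝ)) 𝓘(ℝ, ℝ) ∞ (fun p : M × ℝ ↦ H p.2 p.1)
      (univ ×ˢ Icc (0 : ℝ) 1)) {x₀ x : M} (hx : x ∈ (extChartAt 𝓘(ℝ, E) x₀).source) {r : ℝ}
    (hr : r ∈ Ioo (0 : ℝ) 1) :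
    HasFDerivAt (familyInChart (E := E) H x₀)
      (familyFDeriv H x₀ (extChartAt 𝓘(ℝ, E) x₀ x, r)) (extChartAt 𝓘(ℝ, E) x₀ x, r) :=
  (hasFDerivWithinAt_familyInChart hH hx (Ioo_subset_Icc_self hr)).hasFDerivAt
    (prod_mem_nhds (extChartAt_target_mem_nhds'
      ((extChartAt 𝓘(ℝ, E) x₀).map_source hx)) (Icc_mem_nhds hr.1 hr.2))

/-- Holds at r = 0 and r = 1 too: the slice y ↦ (y, r) stays in the slab and is open in the space
direction, so the one-sided derivative restricts to a full derivative in y. The endpoint r = 1 is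
where the limit is taken. -/
lemma mvfderiv_eq_familyFDeriv
    (hH : ContMDiffOn (𝓘(ℝ, E).prod 𝓘(ℝ, ℝ)) 𝓘(ℝ, ℝ) ∞ (fun p : M × ℝ ↦ H p.2 p.1)
      (univ ×ˢ Icc (0 : ℝ) 1)) {x₀ x : M} (hx : x ∈ (extChartAt 𝓘(ℝ, E) x₀).source) {r : ℝ}
    (hr : r ∈ Icc (0 : ℝ) 1) (v : E) :
    mvfderiv 𝓘(ℝ, E) (H r) x v =
      familyFDeriv H x₀ (extChartAt 𝓘(ℝ, E) x₀ x, r) (chartDeriv x₀ x v, 0) := by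
  have h1 : HasFDerivWithinAt (fun y : E ↦ (y, r)) (ContinuousLinearMap.inl ℝ E ℝ)
      (extChartAt 𝓘(ℝ, E) x₀).target (extChartAt 𝓘(ℝ, E) x₀ x) :=
    (hasFDerivAt_prodMk_left _ _).hasFDerivWithinAt
  have h2 := ((hasFDerivWithinAt_familyInChart hH hx hr).comp (extChartAt 𝓘(ℝ, E) x₀ x) h1
    (fun y hy ↦ mk_mem_prod hy hr)).hasFDerivAt (extChartAt_target_mem_nhds'
      ((extChartAt 𝓘(ℝ, E) x₀).map_source hx))
  exact mvfderiv_eq_of_hasFDerivAt_inChart (h := H r) hx h2 v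

lemma hasDerivAt_family_param
    (hH : ContMDiffOn (𝓘(ℝ, E).prod 𝓘(ℝ, ℝ)) 𝓘(ℝ, ℝ) ∞ (fun p : M × ℝ ↦ H p.2 p.1)
      (univ ×ˢ Icc (0 : ℝ) 1)) {x₀ x : M} (hx : x ∈ (extChartAt 𝓘(ℝ, E) x₀).source) {r : ℝ}
    (hr : r ∈ Ioo (0 : ℝ) 1) :
    HasDerivAt (fun s ↦ H s x)
      (familyFDeriv (E := E) H x₀ (extChartAt 𝓘(ℝ, E) x₀ x, r) (0, 1)) r := by
  have h1 := ((hasFDerivAt_familyInChart hH hx hr).comp r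
    (hasFDerivAt_prodMk_right (𝕜 := ℝ) (extChartAt 𝓘(ℝ, E) x₀ x) r)).hasDerivAt
  have h2 : familyInChart (E := E) H x₀ ∘ (fun s ↦ (extChartAt 𝓘(ℝ, E) x₀ x, s)) =
      fun s ↦ H s x := by
    ext s
    simp only [Function.comp_apply, familyInChart, (extChartAt 𝓘(ℝ, E) x₀).left_inv hx]
  rw [h2] at h1
  simpa using h1

lemma continuousOn_familyFDeriv
    (hH : ContMDiffOn (𝓘(ℝ, E).prod 𝓘(ℝ, ℝ)) 𝓘(ℝ, ℝ) ∞ (fun p : M × ℝ ↦ H p.2 p.1)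
      (univ ×ˢ Icc (0 : ℝ) 1)) (x₀ : M) :
    ContinuousOn (familyFDeriv (E := E) H x₀)
      ((extChartAt 𝓘(ℝ, E) x₀).target ×ˢ Icc (0 : ℝ) 1) :=
  (contDiffOn_familyInChart hH x₀).continuousOn_fderivWithin (uniqueDiffOn_target_prod_Icc x₀)
    (by simp)

lemma tendsto_familyFDeriv
    (hH : ContMDiffOn (𝓘(ℝ, E).prod 𝓘(ℝ, ℝ)) 𝓘(ℝ, ℝ) ∞ (fun p : M × ℝ ↦ H p.2 p.1)
      (univ ×ˢ Icc (0 : ℝ) 1)) (x₀ : M) {r₀ : ℝ} (hr₀ : r₀ ∈ Icc (0 : ℝ) 1) :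
    Tendsto (fun p : M × ℝ ↦ familyFDeriv (E := E) H x₀ (extChartAt 𝓘(ℝ, E) x₀ p.1, p.2))
      (𝓝[univ ×ˢ Icc (0 : ℝ) 1] (x₀, r₀))
      (𝓝 (familyFDeriv H x₀ (extChartAt 𝓘(ℝ, E) x₀ x₀, r₀))) := by
  have h := continuousOn_familyFDeriv hH x₀ (extChartAt 𝓘(ℝ, E) x₀ x₀, r₀)
    ⟨mem_extChartAt_target x₀, hr₀⟩
  refine Tendsto.comp h (tendsto_nhdsWithin_iff.2 ⟨?_, ?_⟩)
  · refine Tendsto.mono_left ?_ nhdsWithin_le_nhds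
    exact ((continuousAt_extChartAt (I := 𝓘(ℝ, E)) x₀).tendsto.comp
      continuousAt_fst.tendsto).prodMk_nhds continuousAt_snd.tendsto
  · have h1 : ∀ᶠ p : M × ℝ in 𝓝[univ ×ˢ Icc (0 : ℝ) 1] (x₀, r₀),
        p.1 ∈ (extChartAt 𝓘(ℝ, E) x₀).source :=
      nhdsWithin_le_nhds (continuousAt_fst.eventually
        (extChartAt_source_mem_nhds (I := 𝓘(ℝ, E)) x₀))
    filter_upwards [h1, self_mem_nhdsWithin] with p hp hp2
    exact ⟨(extChartAt 𝓘(ℝ, E) x₀).map_source hp, hp2.2⟩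

variable [FiniteDimensional ℝ E]

/-- Read in a single chart, λ, d_x H, dλ and ∂_r H are continuous up to r₀, so
`exists_eventually_abs_apply_reeb_le` applies with these as α, β, B and δ. The bound is claimed only
for parameters in (0,1), where the one-sided ∂_r H is the ordinary derivative, but r₀ may be an
endpoint. -/
lemma exists_eventually_abs_extD_reeb_le (hlam : lam.IsSmooth)
    (hH : ContMDiffOn (𝓘(ℝ, E).prod 𝓘(ℝ, ℝ)) 𝓘(ℝ, ℝ) ∞ (fun p : M × ℝ ↦ H p.2 p.1)
      (univ ×ˢ Icc (0 : ℝ) 1)) {x₀ : M} {r₀ : ℝ} (hr₀ : r₀ ∈ Icc (0 : ℝ) 1)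
    (hx₀ : H r₀ x₀ = 0) (hreg : ZeroIsRegularValue (E := E) (H r₀))
    (hcontact : IsContactOnZeroSet lam (H r₀)) :
    ∃ C : ℝ, ∀ᶠ p : M × ℝ in 𝓝[univ ×ˢ Icc (0 : ℝ) 1] (x₀, r₀), p.2 ∈ Ioo (0 : ℝ) 1 →
      ∀ R u : TangentSpace 𝓘(ℝ, E) p.1, IsReebVector lam (H p.2) p.1 R →
        mvfderiv 𝓘(ℝ, E) (H p.2) p.1 u = -deriv (fun s ↦ H s p.1) p.2 →
        |lam.extD p.1 u R| ≤ C := by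
  have hsrc := mem_extChartAt_source (I := 𝓘(ℝ, E)) x₀
  have hD := tendsto_familyFDeriv hH x₀ hr₀
  have hφ : Tendsto (fun p : M × ℝ ↦ extChartAt 𝓘(ℝ, E) x₀ p.1)
      (𝓝[univ ×ˢ Icc (0 : ℝ) 1] (x₀, r₀)) (𝓝 (extChartAt 𝓘(ℝ, E) x₀ x₀)) :=
    ((continuousAt_extChartAt (I := 𝓘(ℝ, E)) x₀).tendsto.comp
      continuousAt_fst.tendsto).mono_left nhdsWithin_le_nhds
  have hA := hlam.contDiffAt_inChart x₀
  have hα := hA.continuousAt.tendsto.comp hφ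
  have hdA : ContinuousAt (fderiv ℝ (lam.inChart x₀)) (extChartAt 𝓘(ℝ, E) x₀ x₀) :=
    (hA.fderiv_right (m := 0) (by simp)).continuousAt
  have hdA' : Tendsto (lam.dInChart x₀) (𝓝 (extChartAt 𝓘(ℝ, E) x₀ x₀))
      (𝓝 (lam.dInChart x₀ (extChartAt 𝓘(ℝ, E) x₀ x₀))) :=
    hdA.tendsto.sub
      (((ContinuousLinearMap.flipₗᵢ ℝ E E ℝ).continuous.tendsto _).comp hdA.tendsto)
  have hB := hdA'.comp hφ
  have hβ : Tendsto (fun p : M × ℝ ↦ (familyFDeriv (E := E) H x₀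
      (extChartAt 𝓘(ℝ, E) x₀ p.1, p.2)).comp (ContinuousLinearMap.inl ℝ E ℝ))
      (𝓝[univ ×ˢ Icc (0 : ℝ) 1] (x₀, r₀)) (𝓝 ((familyFDeriv H x₀
        (extChartAt 𝓘(ℝ, E) x₀ x₀, r₀)).comp (ContinuousLinearMap.inl ℝ E ℝ))) :=
    (((ContinuousLinearMap.compL ℝ E (E × ℝ) ℝ).flip
      (ContinuousLinearMap.inl ℝ E ℝ)).continuous.tendsto _).comp hD
  have hδ := ((ContinuousLinearMap.apply ℝ ℝ ((0 : E), (1 : ℝ))).continuous.tendsto _).comp hD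
  have hA2 := hlam.eventually_contDiffAt_inChart x₀
  have hext0 : ∀ u v : E, lam.extD x₀ u v = lam.dInChart x₀ (extChartAt 𝓘(ℝ, E) x₀ x₀)
      (chartDeriv x₀ x₀ u) (chartDeriv x₀ x₀ v) := fun u v ↦
    lam.extD_eq_dInChart hsrc (hA.differentiableAt (by simp)) u v
  obtain ⟨C, hC⟩ := exists_eventually_abs_apply_reeb_le hα hβ hB hδ
    (by
      intro a
      obtain ⟨v, hv⟩ := hreg x₀ hx₀ a
      exact ⟨chartDeriv x₀ x₀ v, (mvfderiv_eq_familyFDeriv hH hsrc hr₀ v).symm.trans hv⟩)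
    (by
      intro u hu1 hu2 hu3
      have hu : chartDeriv x₀ x₀ (chartSymmDeriv x₀ (extChartAt 𝓘(ℝ, E) x₀ x₀) u) = u :=
        chartDeriv_chartSymmDeriv hsrc u
      have h0 : chartSymmDeriv x₀ (extChartAt 𝓘(ℝ, E) x₀ x₀) u = 0 := by
        -- The contact condition tests only against v with λ(v) = 0; here the pairing vanishes for
        -- all v tangent to the level set.
        refine (hcontact x₀ hx₀).2 _ ?_ ?_ fun v hv _ ↦ ?_
        · refine LinearMap.mem_ker.2 ((mvfderiv_eq_familyFDeriv hH hsrc hr₀ _).trans ?_)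
          rw [hu]
          exact hu1
        · refine (lam.apply_eq_inChart hsrc _).trans ?_
          rw [hu]
          exact hu2
        · refine (hext0 _ _).trans ?_
          rw [hu]
          refine hu3 _ ?_
          exact (mvfderiv_eq_familyFDeriv hH hsrc hr₀ _).symm.trans (LinearMap.mem_ker.1 hv)
      rw [← hu, h0, map_zero])
  refine ⟨C, ?_⟩
  have hsource : ∀ᶠ p : M × ℝ in 𝓝[univ ×ˢ Icc (0 : ℝ) 1] (x₀, r₀),
      p.1 ∈ (extChartAt 𝓘(ℝ, E) x₀).source :=
    nhdsWithin_le_nhds (continuousAt_fst.eventually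
      (extChartAt_source_mem_nhds (I := 𝓘(ℝ, E)) x₀))
  filter_upwards [hC, hsource, hφ.eventually hA2] with p hp hps hpA hr R u hR hu
  have hrI := Ioo_subset_Icc_self hr
  have hAd := hpA.differentiableAt (by simp)
  have hext := lam.extD_eq_dInChart hps hAd
  refine (congrArg abs ((hext u R).trans (lam.dInChart_swap _ _ _ _))).trans_le ?_
  rw [abs_neg]
  refine hp (chartDeriv x₀ p.1 R) (chartDeriv x₀ p.1 u) ?_ ?_ ?_ ?_
  · exact (mvfderiv_eq_familyFDeriv hH hps hrI _).symm.trans (LinearMap.mem_ker.1 hR.tangent)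
  · exact (lam.apply_eq_inChart hps _).symm.trans hR.normalized
  · intro v hv
    have hv' := chartDeriv_chartSymmDeriv hps v
    have h1 := hR.kernel (chartSymmDeriv x₀ (extChartAt 𝓘(ℝ, E) x₀ p.1) v)
      (by
        refine LinearMap.mem_ker.2 ((mvfderiv_eq_familyFDeriv hH hps hrI _).trans ?_)
        rw [hv']
        exact hv)
    have h2 := (hext _ _).symm.trans h1
    rw [hv'] at h2
    exact h2
  · refine (mvfderiv_eq_familyFDeriv hH hps hrI _).symm.trans (hu.trans ?_)
    rw [(hasDerivAt_family_param (E := E) hH hps hr).deriv]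
    rfl

/-- On a compact family of contact level sets, the exterior derivative of the contact form pairs
boundedly with the Reeb field and the vectors that follow the motion of the level sets. -/
lemma exists_abs_extD_reeb_le (hlam : lam.IsSmooth)
    (hH : ContMDiffOn (𝓘(ℝ, E).prod 𝓘(ℝ, ℝ)) 𝓘(ℝ, ℝ) ∞ (fun p : M × ℝ ↦ H p.2 p.1)
      (univ ×ˢ Icc (0 : ℝ) 1))
    (hreg : ∀ r ∈ Icc (0 : ℝ) 1, ZeroIsRegularValue (E := E) (H r))
    (hcomp : IsCompact {p : M × ℝ | p.2 ∈ Icc (0 : ℝ) 1 ∧ H p.2 p.1 = 0})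
    (hcontact : ∀ r ∈ Icc (0 : ℝ) 1, IsContactOnZeroSet lam (H r)) :
    ∃ C : ℝ, ∀ r ∈ Ioo (0 : ℝ) 1, ∀ (x : M) (R u : TangentSpace 𝓘(ℝ, E) x),
      IsReebVector lam (H r) x R →
        mvfderiv 𝓘(ℝ, E) (H r) x u = -deriv (fun s ↦ H s x) r → |lam.extD x u R| ≤ C := by
  suffices h : ∃ C : ℝ, ∀ p ∈ {p : M × ℝ | p.2 ∈ Icc (0 : ℝ) 1 ∧ H p.2 p.1 = 0},
      p.2 ∈ Ioo (0 : ℝ) 1 → ∀ R u : TangentSpace 𝓘(ℝ, E) p.1, IsReebVector lam (H p.2) p.1 R →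
        mvfderiv 𝓘(ℝ, E) (H p.2) p.1 u = -deriv (fun s ↦ H s p.1) p.2 →
        |lam.extD p.1 u R| ≤ C by
    obtain ⟨C, hC⟩ := h
    exact ⟨C, fun r hr x R u hR hu ↦
      hC (x, r) ⟨Ioo_subset_Icc_self hr, hR.mem_zeroSet⟩ hr R u hR hu⟩
  -- Having a common bound passes to subsets and finite unions, so by compactness the local bounds
  -- suffice.
  refine hcomp.induction_on (p := fun s ↦ ∃ C : ℝ, ∀ p ∈ s,
      p.2 ∈ Ioo (0 : ℝ) 1 → ∀ R u : TangentSpace 𝓘(ℝ, E) p.1, IsReebVector lam (H p.2) p.1 R →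
        mvfderiv 𝓘(ℝ, E) (H p.2) p.1 u = -deriv (fun s ↦ H s p.1) p.2 →
        |lam.extD p.1 u R| ≤ C) ?_ ?_ ?_ ?_
  · exact ⟨0, by simp⟩
  · rintro s t hst ⟨C, hC⟩
    exact ⟨C, fun p hp ↦ hC p (hst hp)⟩
  · rintro s t ⟨C, hC⟩ ⟨C', hC'⟩
    refine ⟨max C C', ?_⟩
    rintro p (hp | hp) hr R u hR hu
    · exact (hC p hp hr R u hR hu).trans (le_max_left _ _)
    · exact (hC' p hp hr R u hR hu).trans (le_max_right _ _)
  · rintro ⟨x₀, r₀⟩ ⟨hr₀, hx₀⟩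
    obtain ⟨C, hC⟩ := exists_eventually_abs_extD_reeb_le hlam hH hr₀ hx₀ (hreg r₀ hr₀)
      (hcontact r₀ hr₀)
    exact ⟨_, nhdsWithin_mono _ (fun p hp ↦ mk_mem_prod (mem_univ _) hp.1) hC, C, fun p hp ↦ hp⟩

end LevelSets

/-! ### First variation of the period -/

section OrbitCalculus

variable {E : Type*} [NormedAddCommGroup E] [NormedSpace ℝ E]

/-- Product rule for the coefficient of Γ^*A along b. The second-derivative term is symmetric in a
and b, so exchanging them and subtracting leaves dA. -/
lemma hasFDerivAt_fderiv_apply {P : Type*} [NormedAddCommGroup P] [NormedSpace ℝ P]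
    {A : E → E →L[ℝ] ℝ} {Γ : P → E} {q : P}
    (hA : DifferentiableAt ℝ A (Γ q)) (hΓ : ContDiffAt ℝ 2 Γ q) (b : P) :
    ∃ L : P →L[ℝ] ℝ, HasFDerivAt (fun z ↦ A (Γ z) (fderiv ℝ Γ z b)) L q ∧
      ∀ a, L a = fderiv ℝ A (Γ q) (fderiv ℝ Γ q a) (fderiv ℝ Γ q b) +
        A (Γ q) (fderiv ℝ (fderiv ℝ Γ) q a b) := by
  have h1 : HasFDerivAt Γ (fderiv ℝ Γ q) q := (hΓ.differentiableAt (by simp)).hasFDerivAt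
  have h2 : HasFDerivAt (fderiv ℝ Γ) (fderiv ℝ (fderiv ℝ Γ) q) q :=
    ((hΓ.fderiv_right (m := 1) (by norm_num)).differentiableAt (by simp)).hasFDerivAt
  have h3 := (hA.hasFDerivAt.comp q h1).clm_apply (h2.clm_apply (hasFDerivAt_const b q))
  refine ⟨_, h3, fun a ↦ ?_⟩
  simp [add_comm]

variable {M : Type*} [TopologicalSpace M] [ChartedSpace E M]

/-- The variation field `∂_r γ` of a family of curves. -/
noncomputable def variationField (γ : ℝ → ℝ → M) (r t : ℝ) : E :=
  mfderiv 𝓘(ℝ, ℝ) 𝓘(ℝ, E) (fun s ↦ γ s t) r (1 : ℝ)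

variable {lam : OneForm E M} {H : ℝ → M → ℝ} {γ : ℝ → ℝ → M} {τ : ℝ → ℝ}

lemma mdifferentiableAt_param {r t : ℝ}
    (hγ : ContMDiffAt 𝓘(ℝ, ℝ × ℝ) 𝓘(ℝ, E) ∞ (fun p : ℝ × ℝ ↦ γ p.1 p.2) (r, t)) :
    MDifferentiableAt 𝓘(ℝ, ℝ) 𝓘(ℝ, E) (fun s ↦ γ s t) r := by
  have h1 : ContMDiffAt 𝓘(ℝ, ℝ) 𝓘(ℝ, ℝ × ℝ) ∞ (fun s : ℝ ↦ (s, t)) r :=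
    (contDiff_id.prodMk contDiff_const).contMDiff.contMDiffAt
  exact (ContMDiffAt.comp (g := fun p : ℝ × ℝ ↦ γ p.1 p.2) r hγ h1).mdifferentiableAt (by simp)

lemma IsPeriodicReebFamily.contMDiffAt (hγ : IsPeriodicReebFamily lam H γ τ) {r : ℝ}
    (hr : r ∈ Ioo (0 : ℝ) 1) (t : ℝ) :
    ContMDiffAt 𝓘(ℝ, ℝ × ℝ) 𝓘(ℝ, E) ∞ (fun p : ℝ × ℝ ↦ γ p.1 p.2) (r, t) :=
  hγ.smooth_orbit.contMDiffAt (prod_mem_nhds (Ico_mem_nhds hr.1 hr.2) univ_mem)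

/-- Differentiating γ_s(0) = γ_s(1) in s shows that the variation field closes up; this is the
boundary condition for Rolle's theorem. -/
lemma IsPeriodicReebFamily.variation_one (hγ : IsPeriodicReebFamily lam H γ τ) {r : ℝ}
    (hr : r ∈ Ioo (0 : ℝ) 1) :
    lam.toModel (γ r 0) (variationField γ r 0) = lam.toModel (γ r 1) (variationField γ r 1) := by
  have h1 : ∀ s ∈ Ioo (0 : ℝ) 1, γ s 0 = γ s 1 := fun s hs ↦ by
    have := hγ.periodic s (Ioo_subset_Ico_self hs) 0
    rw [zero_add] at this
    exact this.symm
  have h2 : (fun s ↦ γ s 0) =ᶠ[𝓝 r] fun s ↦ γ s 1 := by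
    filter_upwards [Ioo_mem_nhds hr.1 hr.2] with s hs using h1 s hs
  have h3 : variationField (E := E) γ r 0 = variationField γ r 1 :=
    congrArg (fun L : ℝ →L[ℝ] E ↦ L 1)
      (show (mfderiv 𝓘(ℝ, ℝ) 𝓘(ℝ, E) (fun s ↦ γ s 0) r : ℝ →L[ℝ] E) =
        mfderiv 𝓘(ℝ, ℝ) 𝓘(ℝ, E) (fun s ↦ γ s 1) r from h2.mfderiv_eq)
  rw [h1 r hr, h3]

variable [IsManifold 𝓘(ℝ, E) ∞ M]

lemma hasDerivAt_extChartAt_variationField {x₀ : M} {r t : ℝ}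
    (hγ : ContMDiffAt 𝓘(ℝ, ℝ × ℝ) 𝓘(ℝ, E) ∞ (fun p : ℝ × ℝ ↦ γ p.1 p.2) (r, t))
    (hx : γ r t ∈ (extChartAt 𝓘(ℝ, E) x₀).source) :
    HasDerivAt (fun s ↦ extChartAt 𝓘(ℝ, E) x₀ (γ s t))
      (chartDeriv x₀ (γ r t) (variationField γ r t)) r :=
  (mdifferentiableAt_param hγ).hasMFDerivAt.hasDerivAt_extChartAt hx

lemma contDiffAt_extChartAt_comp {x₀ : M} {q : ℝ × ℝ}
    (hγ : ContMDiffAt 𝓘(ℝ, ℝ × ℝ) 𝓘(ℝ, E) ∞ (fun p : ℝ × ℝ ↦ γ p.1 p.2) q)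
    (hx : γ q.1 q.2 ∈ (extChartAt 𝓘(ℝ, E) x₀).source) :
    ContDiffAt ℝ ∞ (fun p : ℝ × ℝ ↦ extChartAt 𝓘(ℝ, E) x₀ (γ p.1 p.2)) q := by
  refine contMDiffAt_iff_contDiffAt.1 ?_
  exact ContMDiffAt.comp (g := extChartAt 𝓘(ℝ, E) x₀) (f := fun p : ℝ × ℝ ↦ γ p.1 p.2) q
    (contMDiffAt_extChartAt' (mem_chart_source_of_mem_extChartAt hx)) hγ

lemma fderiv_extChartAt_comp_fst {x₀ : M} {r t : ℝ}
    (hγ : ContMDiffAt 𝓘(ℝ, ℝ × ℝ) 𝓘(ℝ, E) ∞ (fun p : ℝ × ℝ ↦ γ p.1 p.2) (r, t))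
    (hx : γ r t ∈ (extChartAt 𝓘(ℝ, E) x₀).source) :
    fderiv ℝ (fun p : ℝ × ℝ ↦ extChartAt 𝓘(ℝ, E) x₀ (γ p.1 p.2)) (r, t) (1, 0) =
      chartDeriv x₀ (γ r t) (variationField γ r t) := by
  have h1 := (((contDiffAt_extChartAt_comp hγ hx).differentiableAt (by simp)).hasFDerivAt.comp r
    (hasFDerivAt_prodMk_left (𝕜 := ℝ) r t)).hasDerivAt
  have h2 := hasDerivAt_extChartAt_variationField hγ hx
  have h3 := h1.unique h2
  simpa using h3

lemma fderiv_extChartAt_comp_snd {x₀ : M} {r t : ℝ} {V : E}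
    (hγ : ContMDiffAt 𝓘(ℝ, ℝ × ℝ) 𝓘(ℝ, E) ∞ (fun p : ℝ × ℝ ↦ γ p.1 p.2) (r, t))
    (hx : γ r t ∈ (extChartAt 𝓘(ℝ, E) x₀).source)
    (hV : HasMFDerivAt 𝓘(ℝ, ℝ) 𝓘(ℝ, E) (γ r) t ((1 : ℝ →L[ℝ] ℝ).smulRight V)) :
    fderiv ℝ (fun p : ℝ × ℝ ↦ extChartAt 𝓘(ℝ, E) x₀ (γ p.1 p.2)) (r, t) (0, 1) =
      chartDeriv x₀ (γ r t) V := by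
  have h1 := (((contDiffAt_extChartAt_comp hγ hx).differentiableAt (by simp)).hasFDerivAt.comp t
    (hasFDerivAt_prodMk_right (𝕜 := ℝ) r t)).hasDerivAt
  have hV1 : ((1 : ℝ →L[ℝ] ℝ).smulRight V) 1 = V := by simp
  have h2 := (HasMFDerivAt.hasDerivAt_extChartAt (x₀ := x₀) hV hx).congr_deriv
    (congrArg (chartDeriv x₀ (γ r t)) hV1)
  have h3 := h1.unique h2
  simpa using h3

/-- The infinitesimal first variation formula for the action of a family of Reeb orbits. -/
lemma IsPeriodicReebFamily.hasDerivAt_variation (hγ : IsPeriodicReebFamily lam H γ τ)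
    (hlam : lam.IsSmooth) {r t : ℝ} (hr : r ∈ Ioo (0 : ℝ) 1) {R : E}
    (hR : HasMFDerivAt 𝓘(ℝ, ℝ) 𝓘(ℝ, E) (γ r) t ((1 : ℝ →L[ℝ] ℝ).smulRight (τ r • R))) :
    HasDerivAt (fun s ↦ lam.toModel (γ r s) (variationField γ r s))
      (deriv τ r - τ r * lam.extD (γ r t) (variationField (E := E) γ r t) R) t := by
  set x₀ := γ r t with hx₀
  set Γ : ℝ × ℝ → E := fun p ↦ extChartAt 𝓘(ℝ, E) x₀ (γ p.1 p.2) with hΓdef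
  set A := lam.inChart x₀ with hAdef
  have hsrc : γ r t ∈ (extChartAt 𝓘(ℝ, E) x₀).source := mem_extChartAt_source x₀
  have hγq := hγ.contMDiffAt hr t
  have hΓ : ContDiffAt ℝ 2 Γ (r, t) := (contDiffAt_extChartAt_comp hγq hsrc).of_le two_le_infty
  have hA : DifferentiableAt ℝ A (Γ (r, t)) :=
    (hlam.contDiffAt_inChart x₀).differentiableAt (by simp)
  have hnear : ∀ᶠ q : ℝ × ℝ in 𝓝 (r, t), γ q.1 q.2 ∈ (extChartAt 𝓘(ℝ, E) x₀).source :=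
    hγq.continuousAt.eventually (extChartAt_source_mem_nhds (I := 𝓘(ℝ, E)) x₀)
  have hc1 : Tendsto (fun s : ℝ ↦ (s, t)) (𝓝 r) (𝓝 (r, t)) :=
    (continuous_id.prodMk continuous_const).tendsto r
  have hc2 : Tendsto (fun s : ℝ ↦ (r, s)) (𝓝 t) (𝓝 (r, t)) :=
    (continuous_const.prodMk continuous_id).tendsto t
  obtain ⟨L₁, hL₁, hL₁a⟩ := hasFDerivAt_fderiv_apply hA hΓ (0, 1)
  obtain ⟨L₂, hL₂, hL₂a⟩ := hasFDerivAt_fderiv_apply hA hΓ (1, 0)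
  -- At fixed t, the function s ↦ λ(∂_t γ_s) is τ_s, since λ(R) = 1. Thus τ' is the r-derivative of
  -- λ(∂_t γ).
  have hτ : HasDerivAt τ (L₁ (1, 0)) r := by
    have h1 := (hL₁.comp r (hasFDerivAt_prodMk_left (𝕜 := ℝ) r t)).hasDerivAt
    have h2 : (L₁.comp (ContinuousLinearMap.inl ℝ ℝ ℝ)) 1 = L₁ (1, 0) := by simp
    rw [h2] at h1
    refine h1.congr_of_eventuallyEq ?_
    filter_upwards [hc1.eventually hnear, Ioo_mem_nhds hr.1 hr.2] with s hs hsI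
    obtain ⟨R', hR', hR'd⟩ := hγ.velocity s (Ioo_subset_Ico_self hsI) t
    have h3 : A (Γ (s, t)) (fderiv ℝ Γ (s, t) (0, 1)) =
        lam.toModel (γ s t) (τ s • (show E from R')) := by
      rw [fderiv_extChartAt_comp_snd (hγ.contMDiffAt hsI t) hs hR'd]
      exact (lam.apply_eq_inChart hs _).symm
    have h4 : lam.toModel (γ s t) (show E from R') = 1 := hR'.normalized
    rw [map_smul, h4] at h3
    simpa using h3.symm
  have hg : HasDerivAt (fun s ↦ lam.toModel (γ r s) (variationField γ r s)) (L₂ (0, 1)) t := by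
    have h1 := (hL₂.comp t (hasFDerivAt_prodMk_right (𝕜 := ℝ) r t)).hasDerivAt
    have h2 : (L₂.comp (ContinuousLinearMap.inr ℝ ℝ ℝ)) 1 = L₂ (0, 1) := by simp
    rw [h2] at h1
    refine h1.congr_of_eventuallyEq ?_
    filter_upwards [hc2.eventually hnear] with s hs
    refine (lam.apply_eq_inChart hs _).trans ?_
    rw [← fderiv_extChartAt_comp_fst (hγ.contMDiffAt hr s) hs]
    rfl
  have hsymm : fderiv ℝ (fderiv ℝ Γ) (r, t) (1, 0) (0, 1) =
      fderiv ℝ (fderiv ℝ Γ) (r, t) (0, 1) (1, 0) :=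
    (hΓ.isSymmSndFDerivAt (by simp)) (1, 0) (0, 1)
  have hext : τ r * lam.extD (γ r t) (variationField (E := E) γ r t) R =
      lam.dInChart x₀ (Γ (r, t)) (fderiv ℝ Γ (r, t) (1, 0)) (fderiv ℝ Γ (r, t) (0, 1)) := by
    rw [fderiv_extChartAt_comp_snd hγq hsrc hR, fderiv_extChartAt_comp_fst hγq hsrc, map_smul,
      map_smul, smul_eq_mul]
    exact congrArg (τ r * ·) (lam.extD_eq_dInChart hsrc hA _ _)
  -- The r-derivative of λ(∂_t γ) minus the t-derivative of λ(∂_r γ) is dλ(∂_r γ, ∂_t γ), the mixed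
  -- partials cancelling.
  have hval : deriv τ r - τ r * lam.extD (γ r t) (variationField (E := E) γ r t) R =
      L₂ (0, 1) := by
    rw [hτ.deriv, hext, lam.dInChart_apply, hL₁a, hL₂a, hsymm]
    ring
  rw [hval]
  exact hg

/-- The variation field of a family of curves on moving level sets follows the level sets. -/
lemma IsPeriodicReebFamily.mvfderiv_variationField (hγ : IsPeriodicReebFamily lam H γ τ)
    (hH : ContMDiffOn (𝓘(ℝ, E).prod 𝓘(ℝ, ℝ)) 𝓘(ℝ, ℝ) ∞ (fun p : M × ℝ ↦ H p.2 p.1)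
      (univ ×ˢ Icc (0 : ℝ) 1)) {r : ℝ} (hr : r ∈ Ioo (0 : ℝ) 1) (t : ℝ) :
    mvfderiv 𝓘(ℝ, E) (H r) (γ r t) (variationField (E := E) γ r t) =
      -deriv (fun s ↦ H s (γ r t)) r := by
  set x₀ := γ r t with hx₀
  have hsrc : γ r t ∈ (extChartAt 𝓘(ℝ, E) x₀).source := mem_extChartAt_source x₀
  have h1 := hasDerivAt_extChartAt_variationField (hγ.contMDiffAt hr t) hsrc
  have h2 := HasFDerivAt.comp_hasDerivAt (f := fun s ↦ (extChartAt 𝓘(ℝ, E) x₀ (γ s t), id s)) r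
    (hasFDerivAt_familyInChart hH hsrc hr) (h1.prodMk (hasDerivAt_id r))
  have hcont : ContinuousAt (fun s ↦ γ s t) r :=
    (mdifferentiableAt_param (hγ.contMDiffAt hr t)).continuousAt
  -- The orbit γ_s lies on the zero set of H_s, so H_s(γ_s(t)) vanishes identically near r.
  have h3 : (familyInChart (E := E) H x₀ ∘ fun s ↦ (extChartAt 𝓘(ℝ, E) x₀ (γ s t), id s))
      =ᶠ[𝓝 r] fun _ ↦ (0 : ℝ) := by
    filter_upwards [hcont.eventually (extChartAt_source_mem_nhds (I := 𝓘(ℝ, E)) x₀),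
      Ioo_mem_nhds hr.1 hr.2] with s hs hsI
    obtain ⟨R', hR', -⟩ := hγ.velocity s (Ioo_subset_Ico_self hsI) t
    simp only [Function.comp_apply, familyInChart, id,
      (extChartAt 𝓘(ℝ, E) x₀).left_inv hs, hR'.mem_zeroSet]
  have h4 := (h2.congr_of_eventuallyEq h3.symm).unique (hasDerivAt_const r (0 : ℝ))
  rw [(hasDerivAt_family_param (E := E) hH hsrc hr).deriv]
  refine (mvfderiv_eq_familyFDeriv hH hsrc (Ioo_subset_Icc_self hr) _).trans ?_
  rw [eq_neg_iff_add_eq_zero, ← map_add]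
  simpa using h4

/-- The period of a family of Reeb orbits satisfies a linear differential inequality. -/
lemma IsPeriodicReebFamily.abs_deriv_period_le (hγ : IsPeriodicReebFamily lam H γ τ)
    (hlam : lam.IsSmooth)
    (hH : ContMDiffOn (𝓘(ℝ, E).prod 𝓘(ℝ, ℝ)) 𝓘(ℝ, ℝ) ∞ (fun p : M × ℝ ↦ H p.2 p.1)
      (univ ×ˢ Icc (0 : ℝ) 1)) {C : ℝ}
    (hC : ∀ r ∈ Ioo (0 : ℝ) 1, ∀ (x : M) (R u : TangentSpace 𝓘(ℝ, E) x),
      IsReebVector lam (H r) x R →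
        mvfderiv 𝓘(ℝ, E) (H r) x u = -deriv (fun s ↦ H s x) r → |lam.extD x u R| ≤ C)
    {r : ℝ} (hr : r ∈ Ioo (0 : ℝ) 1) : |deriv τ r| ≤ C * τ r := by
  choose R hR hRd using hγ.velocity r (Ioo_subset_Ico_self hr)
  have hd := fun t ↦ hγ.hasDerivAt_variation hlam hr (hRd t)
  -- Rolle's theorem replaces integration over the period: one time t suffices, as the bound `C` is
  -- uniform in the point.
  obtain ⟨t, -, ht⟩ := exists_hasDerivAt_eq_zero zero_lt_one
    (fun t _ ↦ (hd t).continuousAt.continuousWithinAt) (hγ.variation_one hr) fun t _ ↦ hd t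
  have hpos := hγ.period_pos r (Ioo_subset_Ico_self hr)
  rw [sub_eq_zero.1 ht, abs_mul, abs_of_pos hpos, mul_comm]
  exact mul_le_mul_of_nonneg_right
    (hC r hr _ _ _ (hR t) (hγ.mvfderiv_variationField hH hr t)) hpos.le

end OrbitCalculus

/-! ### Convergence of the period -/

lemma exists_tendsto_of_abs_deriv_le_mul {τ : ℝ → ℝ} {C : ℝ}
    (hpos : ∀ r ∈ Ioo (0 : ℝ) 1, 0 < τ r)
    (hdiff : ∀ r ∈ Ioo (0 : ℝ) 1, DifferentiableAt ℝ τ r)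
    (hderiv : ∀ r ∈ Ioo (0 : ℝ) 1, |deriv τ r| ≤ C * τ r) :
    ∃ τ₁ : ℝ, 0 < τ₁ ∧ Tendsto τ (𝓝[<] 1) (𝓝 τ₁) := by
  -- The logarithmic derivative τ'/τ is bounded by C. Working with log τ also keeps the limit away
  -- from 0.
  have hlog : LipschitzOnWith C.toNNReal (fun r ↦ Real.log (τ r)) (Ioo 0 1) := by
    refine (convex_Ioo 0 1).lipschitzOnWith_of_nnnorm_hasDerivWithin_le
      (fun r hr ↦ (((hdiff r hr).hasDerivAt).log (hpos r hr).ne').hasDerivWithinAt)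
      fun r hr ↦ ?_
    rw [← NNReal.coe_le_coe, coe_nnnorm, Real.norm_eq_abs, abs_div, abs_of_pos (hpos r hr)]
    exact ((div_le_iff₀ (hpos r hr)).2 (hderiv r hr)).trans (Real.le_coe_toNNReal C)
  -- A Lipschitz extension of log τ to ℝ supplies the limit as its value at 1.
  obtain ⟨g, hg, hgτ⟩ := hlog.extend_real
  refine ⟨Real.exp (g 1), Real.exp_pos _, ?_⟩
  have h1 : Tendsto (fun r ↦ Real.exp (g r)) (𝓝[<] 1) (𝓝 (Real.exp (g 1))) :=
    ((Real.continuous_exp.comp hg.continuous).tendsto 1).mono_left nhdsWithin_le_nhds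
  refine h1.congr' ?_
  filter_upwards [Ioo_mem_nhdsLT (zero_lt_one' ℝ)] with r hr
  rw [← hgτ hr, Real.exp_log (hpos r hr)]

theorem theorem7p2 {E : Type*} [NormedAddCommGroup E] [NormedSpace ℝ E] [FiniteDimensional ℝ E]
    {M : Type*} [TopologicalSpace M] [T2Space M] [SecondCountableTopology M]
    [ChartedSpace E M] [IsManifold 𝓘(ℝ, E) ∞ M]
    (lam : OneForm E M) (hlam : IsExactSymplectic lam)
    (H : ℝ → M → ℝ)
    (hH : ContMDiffOn (𝓘(ℝ, E).prod 𝓘(ℝ, ℝ)) 𝓘(ℝ, ℝ) ∞ (fun p : M × ℝ ↦ H p.2 p.1)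
      (univ ×ˢ Icc (0 : ℝ) 1))
    (hreg : ∀ r ∈ Icc (0 : ℝ) 1, ZeroIsRegularValue (E := E) (H r))
    (hconn : ∀ r ∈ Icc (0 : ℝ) 1, IsConnected {x : M | H r x = 0})
    (hcomp : IsCompact {p : M × ℝ | p.2 ∈ Icc (0 : ℝ) 1 ∧ H p.2 p.1 = 0})
    (hcontact : ∀ r ∈ Icc (0 : ℝ) 1, IsContactOnZeroSet lam (H r))
    (γ : ℝ → ℝ → M) (τ : ℝ → ℝ) (hγ : IsPeriodicReebFamily lam H γ τ) :
    ∃ τ₁ : ℝ, 0 < τ₁ ∧ Tendsto τ (𝓝[<] 1) (𝓝 τ₁) := by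
  obtain ⟨C, hC⟩ := exists_abs_extD_reeb_le hlam.smooth hH hreg hcomp hcontact
  refine exists_tendsto_of_abs_deriv_le_mul
    (fun r hr ↦ hγ.period_pos r (Ioo_subset_Ico_self hr))
    (fun r hr ↦ ?_) fun r hr ↦ hγ.abs_deriv_period_le hlam.smooth hH hC hr
  exact ((hγ.smooth_period.differentiableOn (by simp)) r
    (Ioo_subset_Ico_self hr)).differentiableAt (Ico_mem_nhds hr.1 hr.2)
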